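/- Let $n\ge 2$ be an integer, let $K$ be a field, $S=K[x_1,\dots,x_n]$, and let $I_{n,2}=(x_1x_2,\,x_2x_3,\,\dots,\,x_{n-1}x_n)\subset S$ be the path ideal of the path graph on $n$ vertices. For integers $N\ge 0$ and $k\ge 0$ let $\binom{N,\,2}{k}$ denote the coefficient of $x^k$ in $(1+x)^{N}$, and put $d:=n+1-\left\lfloor\frac{n+1}{3}\right\rfloor-\left\lceil\frac{n+1}{3}\right\rceil$. For an integer $a$ (possibly negative) and $k\ge 0$, $\binom{a}{k}=\frac{a(a-1)\cdots(a-k+1)}{k!}$; in particular $\binom{-1}{0}=1$. Then $d=\left\lceil\frac n3\right\rceil$; for $0\le k\le n$ the number of squarefree monomials of degree $k$ in $S$ that do not belong to $I_{n,2}$ is $\binom{n-k+1,\,2}{k}=\binom{n-k+1}{k}$; and (0) for all $0\le k\le \left\lceil\frac n3\right\rceil$, $$\sum_{j=0}^k(-1)^{k-j}\binom{\left\lceil\frac n3\right\rceil-j}{k-j}\binom{n-j+1,\,2}{j}=\sum_{\ell=0}^{\lfloor k/2\rfloor}(-1)^\ell\sum_{j=2\ell}^{k}(-1)^{k-j}\binom{\left\lceil\frac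 n3\right\rceil-j}{k-j}\binom{n-j+1}{\ell}\binom{n-2\ell}{j-2\ell};$$ (1) for all $0\le k\le \left\lceil\frac n3\right\rceil$, $$\sum_{j=0}^k(-1)^{k-j}\binom{\left\lceil\frac n3\right\rceil-j}{k-j}\binom{n-j+1}{j}\ \ge\ 0;$$ (2) for all $0\le k\le \left\lceil\frac n3\right\rceil+1$, $$\sum_{j=0}^k(-1)^{k-j}\binom{\left\lceil\frac n3\right\rceil+1-j}{k-j}\binom{n-j+1}{j}\ \le\ \binom{\left\lfloor\frac{2n}3\right\rfloor+k-2}{k}.$$ -/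

import Mathlib

/-- The squarefree monomial `x_C = ∏_{i ∈ C} x_i` of `K[x_1, …, x_n]`; the variables are indexed
by `Fin n`, so `x_{i+1}` is `X i`. -/
noncomputable def squarefreeMonomial (K : Type*) [Field K] {n : ℕ} (C : Finset (Fin n)) :
    MvPolynomial (Fin n) K :=
  ∏ i ∈ C, MvPolynomial.X i

/-- The `m`-path ideal `I_{n,m}` of the path graph on `n` vertices, generated by the products
`x_{t+1} x_{t+2} ⋯ x_{t+m}` of `m` consecutive variables, `0 ≤ t ≤ n - m`. -/
noncomputable def pathIdeal (K : Type*) [Field K] (n m : ℕ) : Ideal (MvPolynomial (Fin n) K) :=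
  Ideal.span {f | ∃ t : ℕ, t + m ≤ n ∧
    f = squarefreeMonomial K
      (Finset.univ.filter fun i : Fin n => t ≤ (i : ℕ) ∧ (i : ℕ) < t + m)}

/-- `α_k(S/I)`: the number of squarefree monomials of degree `k` that do not belong to `I`. -/
noncomputable def alphaQuot {K : Type*} [Field K] {n : ℕ} (I : Ideal (MvPolynomial (Fin n) K))
    (k : ℕ) : ℕ :=
  Set.ncard {C : Finset (Fin n) | C.card = k ∧ squarefreeMonomial K C ∉ I}

/-- The extended binomial coefficient: the coefficient of `x^k` in
`(1 + x + ⋯ + x^{m-1})^N`. -/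
noncomputable def extBinom (N m k : ℕ) : ℕ :=
  ((∑ i ∈ Finset.range m, (Polynomial.X : Polynomial ℕ) ^ i) ^ N).coeff k

/-- `φ(n,m) = n + 1 - ⌊(n+1)/(m+1)⌋ - ⌈(n+1)/(m+1)⌉`. -/
def pathPhi (n m : ℕ) : ℤ :=
  (n : ℤ) + 1 - ⌊((n : ℚ) + 1) / ((m : ℚ) + 1)⌋ - ⌈((n : ℚ) + 1) / ((m : ℚ) + 1)⌉

/-- A power series over `ℤ` has nonnegative coefficients. -/
def NonnegCoeffs (f : PowerSeries ℤ) : Prop := ∀ k, 0 ≤ PowerSeries.coeff k f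

namespace NonnegCoeffs

variable {f g : PowerSeries ℤ}

theorem add (hf : NonnegCoeffs f) (hg : NonnegCoeffs g) : NonnegCoeffs (f + g) := fun k => by
  rw [map_add]; exact add_nonneg (hf k) (hg k)

theorem mul (hf : NonnegCoeffs f) (hg : NonnegCoeffs g) : NonnegCoeffs (f * g) := fun k => by
  rw [PowerSeries.coeff_mul]
  exact Finset.sum_nonneg fun p _ => mul_nonneg (hf _) (hg _)

theorem one : NonnegCoeffs 1 := fun k => by
  rw [PowerSeries.coeff_one]; split_ifs <;> simp

theorem X : NonnegCoeffs PowerSeries.X := fun k => by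
  rw [PowerSeries.coeff_X]; split_ifs <;> simp

theorem pow (hf : NonnegCoeffs f) (a : ℕ) : NonnegCoeffs (f ^ a) := by
  induction a with
  | zero => simpa using one
  | succ a ih => rw [pow_succ]; exact ih.mul hf

end NonnegCoeffs

/-- The geometric series `1 / (1 - X)`. -/
noncomputable def geomSeries : PowerSeries ℤ := PowerSeries.mk 1

theorem geomSeries_mul_one_sub_X : geomSeries * (1 - PowerSeries.X) = 1 :=
  PowerSeries.mk_one_mul_one_sub_eq_one ℤ

theorem nonnegCoeffs_geomSeries : NonnegCoeffs geomSeries := fun k => by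
  simp [geomSeries]

/-- The independence polynomial of the path on `n` vertices evaluated at `X / (1 - X)`. -/
noncomputable def pathSeries (n : ℕ) : PowerSeries ℤ :=
  ∑ j ∈ Finset.range (n + 1),
    ((n + 1 - j).choose j : PowerSeries ℤ) * (PowerSeries.X * geomSeries) ^ j

theorem choose_add_three_sub_succ (n j : ℕ) :
    (n + 3 - (j + 1)).choose (j + 1) =
      (n + 1 - j).choose j + (n + 2 - (j + 1)).choose (j + 1) := by
  rcases le_or_gt j (n + 1) with h | h
  · have h1 : n + 3 - (j + 1) = (n + 1 - j) + 1 := by omega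
    have h2 : n + 2 - (j + 1) = n + 1 - j := by omega
    rw [h1, h2, Nat.choose_succ_succ]
  · have h1 : n + 3 - (j + 1) = 0 := by omega
    have h2 : n + 2 - (j + 1) = 0 := by omega
    have h3 : n + 1 - j = 0 := by omega
    rw [h1, h2, h3, Nat.choose_eq_zero_of_lt (by omega : 0 < j), zero_add]

theorem pathSeries_eq_sum {n N : ℕ} (h : n ≤ N) :
    pathSeries n = ∑ j ∈ Finset.range (N + 1),
      ((n + 1 - j).choose j : PowerSeries ℤ) * (PowerSeries.X * geomSeries) ^ j := by
  refine Finset.sum_subset (Finset.range_subset_range.2 (by omega)) fun j _ hj => ?_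
  rw [Finset.mem_range] at hj
  rw [Nat.choose_eq_zero_of_lt (by omega)]
  simp

theorem pathSeries_add_two (n : ℕ) :
    pathSeries (n + 2) =
      pathSeries (n + 1) + PowerSeries.X * geomSeries * pathSeries n := by
  rw [pathSeries_eq_sum (le_refl (n + 2)), pathSeries_eq_sum (Nat.le_succ (n + 1)),
    pathSeries_eq_sum (Nat.le_succ n), Finset.sum_range_succ', Finset.sum_range_succ' _ (n + 2),
    Finset.mul_sum, add_right_comm (Finset.sum _ _)]
  congr 1
  · rw [← Finset.sum_add_distrib]
    refine Finset.sum_congr rfl fun j _ => ?_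
    rw [choose_add_three_sub_succ]
    push_cast
    ring

theorem pathSeries_zero : pathSeries 0 = 1 := by simp [pathSeries]

theorem pathSeries_one : pathSeries 1 = geomSeries := by
  have h := geomSeries_mul_one_sub_X
  simp only [pathSeries, Finset.sum_range_succ, Finset.sum_range_zero]
  norm_num
  linear_combination -h

theorem one_sub_X_mul_pathSeries_add_three (n : ℕ) :
    (1 - PowerSeries.X) * pathSeries (n + 3) =
      pathSeries (n + 1) + PowerSeries.X * pathSeries n := by
  have h := geomSeries_mul_one_sub_X
  rw [pathSeries_add_two (n + 1), pathSeries_add_two n]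
  linear_combination
    (PowerSeries.X * (pathSeries (n + 1) + pathSeries n)) * h

theorem one_sub_X_mul_pathSeries_two :
    (1 - PowerSeries.X) * pathSeries 2 = 1 + PowerSeries.X := by
  have h := geomSeries_mul_one_sub_X
  rw [pathSeries_add_two 0, pathSeries_zero, zero_add, pathSeries_one]
  linear_combination (1 + PowerSeries.X) * h

theorem nonnegCoeffs_one_sub_X_pow_mul_pathSeries (m : ℕ) :
    NonnegCoeffs ((1 - PowerSeries.X) ^ (m + 1) * pathSeries (3 * m + 1)) ∧
    NonnegCoeffs ((1 - PowerSeries.X) ^ (m + 1) * pathSeries (3 * m + 2)) ∧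
    NonnegCoeffs ((1 - PowerSeries.X) ^ (m + 1) * pathSeries (3 * m + 3)) := by
  have hq := geomSeries_mul_one_sub_X
  induction m with
  | zero =>
    refine ⟨?_, ?_, ?_⟩
    · have : (1 - PowerSeries.X) ^ (0 + 1) * pathSeries (3 * 0 + 1) = 1 := by
        rw [mul_zero, zero_add, pathSeries_one, pow_one, mul_comm, hq]
      rw [this]; exact .one
    · rw [mul_zero, zero_add, zero_add, pow_one, one_sub_X_mul_pathSeries_two]
      exact .add .one .X
    · rw [mul_zero, zero_add, pow_one, one_sub_X_mul_pathSeries_add_three, pathSeries_zero,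
        zero_add, pathSeries_one]
      exact nonnegCoeffs_geomSeries.add (.mul .X .one)
  | succ m ih =>
    obtain ⟨h1, h2, h3⟩ := ih
    have e1 := one_sub_X_mul_pathSeries_add_three (3 * m + 1)
    have e2 := one_sub_X_mul_pathSeries_add_three (3 * m + 2)
    have e3 := one_sub_X_mul_pathSeries_add_three (3 * m + 3)
    have h4 : NonnegCoeffs ((1 - PowerSeries.X) ^ (m + 2) * pathSeries (3 * m + 4)) := by
      convert h2.add (NonnegCoeffs.X.mul h1) using 1
      linear_combination (1 - PowerSeries.X) ^ (m + 1) * e1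
    refine ⟨h4, ?_, ?_⟩
    · convert h3.add (NonnegCoeffs.X.mul h2) using 1
      linear_combination (1 - PowerSeries.X) ^ (m + 1) * e2
    · convert (nonnegCoeffs_geomSeries.mul h4).add (NonnegCoeffs.X.mul h3) using 1
      linear_combination (1 - PowerSeries.X) ^ (m + 1) * e3 -
        (1 - PowerSeries.X) ^ (m + 1) * pathSeries (3 * m + 4) * hq

theorem nonnegCoeffs_geomSeries_pow_sub (a : ℕ) :
    NonnegCoeffs (geomSeries ^ (a + 2) - geomSeries ^ (a + 1) -
      PowerSeries.X * geomSeries ^ a) := by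
  have hq := geomSeries_mul_one_sub_X
  convert (nonnegCoeffs_geomSeries.pow (a + 1)).mul ((NonnegCoeffs.X.pow 2).mul
    (nonnegCoeffs_geomSeries.add .one)) using 1
  linear_combination (geomSeries ^ (a + 1) + PowerSeries.X * geomSeries ^ a
    + PowerSeries.X * geomSeries ^ (a + 1)) * hq

theorem nonnegCoeffs_geomSeries_pow_sub_pathSeries (m : ℕ) :
    NonnegCoeffs (geomSeries ^ (2 * m) -
      (1 - PowerSeries.X) ^ (m + 2) * pathSeries (3 * m + 2)) ∧
    NonnegCoeffs (geomSeries ^ (2 * m + 1) -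
      (1 - PowerSeries.X) ^ (m + 2) * pathSeries (3 * m + 3)) ∧
    NonnegCoeffs (geomSeries ^ (2 * m + 1) -
      (1 - PowerSeries.X) ^ (m + 3) * pathSeries (3 * m + 4)) := by
  have hq := geomSeries_mul_one_sub_X
  induction m with
  | zero =>
    have e2 := one_sub_X_mul_pathSeries_two
    have e3 := one_sub_X_mul_pathSeries_add_three 0
    have e4 := one_sub_X_mul_pathSeries_add_three 1
    rw [pathSeries_zero, zero_add, zero_add, pathSeries_one] at e3
    rw [pathSeries_one] at e4
    refine ⟨?_, ?_, ?_⟩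
    · convert NonnegCoeffs.X.pow 2 using 1
      linear_combination -(1 - PowerSeries.X) * e2
    · convert (NonnegCoeffs.X.pow 2).mul (nonnegCoeffs_geomSeries.add .one) using 1
      linear_combination -(1 - PowerSeries.X) * e3 + PowerSeries.X * hq
    · convert (NonnegCoeffs.X.pow 2).mul
        (nonnegCoeffs_geomSeries.add (NonnegCoeffs.one.add .one)) using 1
      linear_combination -(1 - PowerSeries.X) ^ 2 * e4 - (1 - PowerSeries.X) * e2 +
        (1 + PowerSeries.X ^ 2) * hq
  | succ m ih =>
    obtain ⟨h1, h2, h3⟩ := ih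
    have e1 := one_sub_X_mul_pathSeries_add_three (3 * m + 2)
    have e2 := one_sub_X_mul_pathSeries_add_three (3 * m + 3)
    have e3 := one_sub_X_mul_pathSeries_add_three (3 * m + 4)
    have h4 : NonnegCoeffs (geomSeries ^ (2 * m + 2) -
        (1 - PowerSeries.X) ^ (m + 3) * pathSeries (3 * m + 5)) := by
      convert (h2.add (NonnegCoeffs.X.mul h1)).add (nonnegCoeffs_geomSeries_pow_sub (2 * m))
        using 1
      linear_combination -(1 - PowerSeries.X) ^ (m + 2) * e1
    refine ⟨h4, ?_, ?_⟩
    · convert ((nonnegCoeffs_geomSeries.mul h3).add (NonnegCoeffs.X.mul h2)).add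
        (nonnegCoeffs_geomSeries_pow_sub (2 * m + 1)) using 1
      linear_combination -(1 - PowerSeries.X) ^ (m + 2) * e2 +
        (1 - PowerSeries.X) ^ (m + 2) * pathSeries (3 * m + 4) * hq
    · convert (h4.add (NonnegCoeffs.X.mul h3)).add
        (nonnegCoeffs_geomSeries_pow_sub (2 * m + 1)) using 1
      linear_combination -(1 - PowerSeries.X) ^ (m + 3) * e3

theorem coeff_one_sub_X_pow (N k : ℕ) :
    PowerSeries.coeff k ((1 - PowerSeries.X : PowerSeries ℤ) ^ N) =
      (-1) ^ k * (N.choose k : ℤ) := by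
  have h : ((1 - PowerSeries.X : PowerSeries ℤ) ^ N) =
      PowerSeries.rescale (-1) (((1 + Polynomial.X : Polynomial ℤ) ^ N : Polynomial ℤ)) := by
    simp [PowerSeries.rescale_X, sub_eq_add_neg]
  rw [h, PowerSeries.coeff_rescale, Polynomial.coeff_coe, Polynomial.coeff_one_add_X_pow]

theorem coeff_one_sub_X_pow_mul_pathSeries {d n k : ℕ} (hd : k ≤ d) (hn : k ≤ n) :
    PowerSeries.coeff k ((1 - PowerSeries.X) ^ d * pathSeries n) =
      ∑ j ∈ Finset.range (k + 1), (-1 : ℤ) ^ (k - j) * ((d - j).choose (k - j) : ℤ) *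
        ((n - j + 1).choose j : ℤ) := by
  rw [pathSeries, Finset.mul_sum, map_sum]
  symm
  refine Finset.sum_subset_zero_on_sdiff (Finset.range_subset_range.2 (by omega))
    (fun j hj => ?_) (fun j hj => ?_)
  · rw [Finset.mem_sdiff, Finset.mem_range, Finset.mem_range] at hj
    rw [show (1 - PowerSeries.X) ^ d * (((n + 1 - j).choose j : PowerSeries ℤ) *
      (PowerSeries.X * geomSeries) ^ j) = PowerSeries.X ^ j * ((1 - PowerSeries.X) ^ d *
      ((n + 1 - j).choose j : PowerSeries ℤ) * geomSeries ^ j) by ring,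
      PowerSeries.coeff_X_pow_mul', if_neg (by omega)]
  · rw [Finset.mem_range] at hj
    have hq : geomSeries ^ j * (1 - PowerSeries.X) ^ j = 1 := by
      rw [← mul_pow, geomSeries_mul_one_sub_X, one_pow]
    have hs : (1 - PowerSeries.X : PowerSeries ℤ) ^ d =
        (1 - PowerSeries.X) ^ (d - j) * (1 - PowerSeries.X) ^ j := by
      rw [← pow_add]; congr 1; omega
    have hc : (((n + 1 - j).choose j : ℕ) : PowerSeries ℤ) =
        PowerSeries.C (((n + 1 - j).choose j : ℕ) : ℤ) := by simp
    rw [show (1 - PowerSeries.X) ^ d * (((n + 1 - j).choose j : PowerSeries ℤ) *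
      (PowerSeries.X * geomSeries) ^ j) = PowerSeries.X ^ j *
      (((n + 1 - j).choose j : PowerSeries ℤ) * (1 - PowerSeries.X) ^ (d - j)) by
        rw [hs]; linear_combination ((1 - PowerSeries.X) ^ (d - j) *
          (((n + 1 - j).choose j : PowerSeries ℤ) * PowerSeries.X ^ j)) * hq,
      PowerSeries.coeff_X_pow_mul', if_pos (by omega), hc, PowerSeries.coeff_C_mul,
      coeff_one_sub_X_pow, show n + 1 - j = n - j + 1 by omega]
    ring

theorem coeff_geomSeries_pow (a k : ℕ) :
    PowerSeries.coeff k (geomSeries ^ a) = Ring.choose ((a : ℤ) + k - 1) k := by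
  rcases a with _ | a
  · rcases k with _ | k
    · simp
    · have h : (((0 : ℕ) : ℤ) + ((k + 1 : ℕ) : ℤ) - 1) = (k : ℤ) := by push_cast; ring
      rw [h, Ring.choose_natCast]
      simp [PowerSeries.coeff_one]
  · have h : (((a + 1 : ℕ) : ℤ) + (k : ℤ) - 1) = ((a + k : ℕ) : ℤ) := by push_cast; ring
    rw [h, Ring.choose_natCast, geomSeries, PowerSeries.mk_one_pow_eq_mk_choose_add,
      PowerSeries.coeff_mk, Nat.choose_symm_add]

/-- Subsets of `{0, …, n - 1}` of size `k` without two consecutive elements. -/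
def sparseSubsets (n k : ℕ) : Finset (Finset ℕ) :=
  ((Finset.range n).powersetCard k).filter fun C => ∀ t ∈ C, t + 1 ∉ C

theorem mem_sparseSubsets {n k : ℕ} {C : Finset ℕ} :
    C ∈ sparseSubsets n k ↔ (∀ t ∈ C, t < n) ∧ C.card = k ∧ ∀ t ∈ C, t + 1 ∉ C := by
  simp [sparseSubsets, Finset.mem_powersetCard, Finset.subset_iff, and_assoc]

theorem sparseSubsets_add_two (n k : ℕ) :
    sparseSubsets (n + 2) (k + 1) =
      sparseSubsets (n + 1) (k + 1) ∪ (sparseSubsets n k).image (insert (n + 1)) := by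
  ext C
  rw [Finset.mem_union, Finset.mem_image, mem_sparseSubsets, mem_sparseSubsets]
  constructor
  · rintro ⟨h1, h2, h3⟩
    by_cases hC : n + 1 ∈ C
    · refine Or.inr ⟨C.erase (n + 1), ?_, Finset.insert_erase hC⟩
      rw [mem_sparseSubsets, Finset.card_erase_of_mem hC, h2]
      refine ⟨fun t ht => ?_, rfl, fun t ht ht' => ?_⟩
      · rw [Finset.mem_erase] at ht
        have := h1 t ht.2
        have : t ≠ n := by rintro rfl; exact h3 t ht.2 hC
        omega
      · exact h3 t (Finset.mem_of_mem_erase ht) (Finset.mem_of_mem_erase ht')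
    · refine Or.inl ⟨fun t ht => ?_, h2, h3⟩
      have := h1 t ht
      have : t ≠ n + 1 := by rintro rfl; exact hC ht
      omega
  · rintro (⟨h1, h2, h3⟩ | ⟨D, hD, rfl⟩)
    · exact ⟨fun t ht => by have := h1 t ht; omega, h2, h3⟩
    · rw [mem_sparseSubsets] at hD
      obtain ⟨h1, h2, h3⟩ := hD
      have hn : n + 1 ∉ D := fun h => by have := h1 _ h; omega
      refine ⟨fun t ht => ?_, by rw [Finset.card_insert_of_notMem hn, h2], fun t ht ht' => ?_⟩
      · rcases Finset.mem_insert.1 ht with rfl | ht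
        · omega
        · have := h1 t ht; omega
      · rcases Finset.mem_insert.1 ht with rfl | ht <;> rcases Finset.mem_insert.1 ht' with h | h
        · omega
        · have := h1 _ h; omega
        · have := h1 _ ht; omega
        · exact h3 t ht h

theorem card_sparseSubsets_add_two (n k : ℕ) :
    (sparseSubsets (n + 2) (k + 1)).card =
      (sparseSubsets (n + 1) (k + 1)).card + (sparseSubsets n k).card := by
  rw [sparseSubsets_add_two, Finset.card_union_of_disjoint, Finset.card_image_of_injOn]
  · intro C hC D hD h
    have hmem : ∀ E ∈ sparseSubsets n k, n + 1 ∉ E := fun E hE h => by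
      have := (mem_sparseSubsets.1 hE).1 _ h; omega
    rw [← Finset.erase_insert (hmem C hC), ← Finset.erase_insert (hmem D hD)]
    exact congrArg (fun E => Finset.erase E (n + 1)) h
  · rw [Finset.disjoint_left]
    intro C hC hC'
    obtain ⟨D, -, rfl⟩ := Finset.mem_image.1 hC'
    have := (mem_sparseSubsets.1 hC).1 _ (Finset.mem_insert_self (n + 1) D)
    omega

theorem card_sparseSubsets_zero_right (n : ℕ) : (sparseSubsets n 0).card = 1 := by
  rw [Finset.card_eq_one]
  refine ⟨∅, ?_⟩
  ext C
  rw [mem_sparseSubsets, Finset.mem_singleton, Finset.card_eq_zero]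
  exact ⟨fun h => h.2.1, by rintro rfl; simp⟩

theorem card_sparseSubsets (n k : ℕ) : (sparseSubsets n k).card = (n + 1 - k).choose k := by
  induction n using Nat.strong_induction_on generalizing k with
  | _ n ih =>
    rcases k with _ | k
    · simp [card_sparseSubsets_zero_right]
    · rcases n with _ | _ | n
      · simp [sparseSubsets]
      · rcases k with _ | k
        · decide
        · rw [Nat.choose_eq_zero_of_lt (by omega), sparseSubsets,
            Finset.powersetCard_eq_empty.2 (by simp)]
          simp
      · rw [card_sparseSubsets_add_two, ih (n + 1) (by omega), ih n (by omega), add_comm]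
        rcases le_or_gt k (n + 1) with h | h
        · have h1 : n + 1 + 1 + 1 - (k + 1) = (n + 1 - k) + 1 := by omega
          have h2 : n + 1 + 1 - (k + 1) = n + 1 - k := by omega
          rw [h1, h2, Nat.choose_succ_succ]
        · have h1 : n + 1 + 1 + 1 - (k + 1) = 0 := by omega
          have h2 : n + 1 + 1 - (k + 1) = 0 := by omega
          have h3 : n + 1 - k = 0 := by omega
          rw [h1, h2, h3, Nat.choose_eq_zero_of_lt (by omega : 0 < k), zero_add]

theorem squarefreeMonomial_eq_monomial (K : Type*) [Field K] {n : ℕ} (C : Finset (Fin n)) :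
    squarefreeMonomial K C =
      MvPolynomial.monomial (∑ i ∈ C, Finsupp.single i 1) (1 : K) := by
  rw [MvPolynomial.monomial_sum_one]
  rfl

theorem sum_single_one_le_iff {n : ℕ} (B C : Finset (Fin n)) :
    (∑ i ∈ B, Finsupp.single i 1 : Fin n →₀ ℕ) ≤ ∑ i ∈ C, Finsupp.single i 1 ↔ B ⊆ C := by
  have h (D : Finset (Fin n)) (i : Fin n) :
      (∑ j ∈ D, Finsupp.single j 1 : Fin n →₀ ℕ) i = if i ∈ D then 1 else 0 := by
    simp [Finsupp.finsetSum_apply, Finsupp.single_apply]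
  rw [Finsupp.le_def]
  simp only [h]
  refine forall_congr' fun i => ?_
  by_cases h1 : i ∈ B <;> by_cases h2 : i ∈ C <;> simp [h1, h2]

theorem squarefreeMonomial_mem_pathIdeal_iff (K : Type*) [Field K] {n : ℕ} (m : ℕ)
    (C : Finset (Fin n)) :
    squarefreeMonomial K C ∈ pathIdeal K n m ↔ ∃ t : ℕ, t + m ≤ n ∧
      (Finset.univ.filter fun i : Fin n => t ≤ (i : ℕ) ∧ (i : ℕ) < t + m) ⊆ C := by
  have h : pathIdeal K n m = Ideal.span ((fun s => MvPolynomial.monomial s (1 : K)) ''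
      {s | ∃ t : ℕ, t + m ≤ n ∧ s = ∑ i ∈ Finset.univ.filter
        (fun i : Fin n => t ≤ (i : ℕ) ∧ (i : ℕ) < t + m), Finsupp.single i 1}) := by
    rw [pathIdeal]
    congr 1
    ext f
    simp only [squarefreeMonomial_eq_monomial, Set.mem_image, Set.mem_ofPred_eq]
    constructor
    · rintro ⟨t, ht, rfl⟩
      exact ⟨_, ⟨t, ht, rfl⟩, rfl⟩
    · rintro ⟨_, ⟨t, ht, rfl⟩, rfl⟩
      exact ⟨t, ht, rfl⟩
  classical
  rw [h, squarefreeMonomial_eq_monomial, MvPolynomial.mem_ideal_span_monomial_image,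
    MvPolynomial.support_monomial, if_neg one_ne_zero]
  simp only [Finset.mem_singleton, forall_eq, Set.mem_ofPred_eq]
  constructor
  · rintro ⟨_, ⟨t, ht, rfl⟩, hle⟩
    exact ⟨t, ht, (sum_single_one_le_iff _ _).1 hle⟩
  · rintro ⟨t, ht, hle⟩
    exact ⟨_, ⟨t, ht, rfl⟩, (sum_single_one_le_iff _ _).2 hle⟩

theorem squarefreeMonomial_notMem_pathIdeal_two_iff (K : Type*) [Field K] {n : ℕ}
    (C : Finset (Fin n)) :
    squarefreeMonomial K C ∉ pathIdeal K n 2 ↔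
      ∀ t ∈ C.map Fin.valEmbedding, t + 1 ∉ C.map Fin.valEmbedding := by
  rw [squarefreeMonomial_mem_pathIdeal_iff]
  simp only [Finset.mem_map, Fin.valEmbedding_apply]
  constructor
  · rintro h _ ⟨i, hi, rfl⟩ ⟨j, hj, hij⟩
    refine h ⟨i, by omega, fun l hl => ?_⟩
    simp only [Finset.mem_filter, Finset.mem_univ, true_and] at hl
    rcases (by omega : (l : ℕ) = i ∨ (l : ℕ) = j) with h | h
    · rwa [Fin.ext h]
    · rwa [Fin.ext h]
  · rintro h ⟨t, ht, hC⟩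
    refine h t ⟨⟨t, by omega⟩, hC ?_, rfl⟩ ⟨⟨t + 1, by omega⟩, hC ?_, rfl⟩ <;> simp

theorem alphaQuot_pathIdeal_two (K : Type*) [Field K] (n k : ℕ) :
    alphaQuot (pathIdeal K n 2) k = (n + 1 - k).choose k := by
  rw [← card_sparseSubsets, ← Set.ncard_coe_finset, alphaQuot]
  refine Set.ncard_congr (fun C _ => C.map Fin.valEmbedding) ?_ ?_ ?_
  · rintro C ⟨hk, hC⟩
    rw [Finset.mem_coe, mem_sparseSubsets, Finset.card_map]
    refine ⟨fun t ht => ?_, hk, (squarefreeMonomial_notMem_pathIdeal_two_iff K C).1 hC⟩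
    obtain ⟨i, -, rfl⟩ := Finset.mem_map.1 ht
    exact i.2
  · intro C D _ _ h
    exact Finset.map_injective _ h
  · intro D hD
    rw [Finset.mem_coe, mem_sparseSubsets] at hD
    have hmap : (D.attachFin hD.1).map Fin.valEmbedding = D := Finset.map_valEmbedding_attachFin hD.1
    refine ⟨D.attachFin hD.1, ⟨by simpa using hD.2.1, ?_⟩, hmap⟩
    rw [squarefreeMonomial_notMem_pathIdeal_two_iff, hmap]
    exact hD.2.2

theorem extBinom_two (N k : ℕ) : extBinom N 2 k = N.choose k := by
  simp [extBinom, Finset.sum_range_succ, Polynomial.coeff_one_add_X_pow]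

theorem choose_succ_eq_sum_neg_one_pow_mul_choose (M j : ℕ) :
    ((M + 1).choose j : ℤ) = ∑ l ∈ Finset.range (j / 2 + 1),
      (-1) ^ l * ((M + 1).choose l : ℤ) * ((M + j - 2 * l).choose (j - 2 * l) : ℤ) := by
  have hfac : ((1 + PowerSeries.X : PowerSeries ℤ)) ^ (M + 1) =
      (-PowerSeries.X ^ 2 + 1) ^ (M + 1) * geomSeries ^ (M + 1) := by
    rw [← mul_pow]
    congr 1
    linear_combination -(1 + PowerSeries.X) * geomSeries_mul_one_sub_X
  have hl : ((M + 1).choose j : ℤ) =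
      PowerSeries.coeff j ((1 + PowerSeries.X : PowerSeries ℤ) ^ (M + 1)) := by
    have h : ((1 + PowerSeries.X : PowerSeries ℤ) ^ (M + 1)) =
        (((1 + Polynomial.X : Polynomial ℤ) ^ (M + 1) : Polynomial ℤ) : PowerSeries ℤ) := by simp
    rw [h, Polynomial.coeff_coe, Polynomial.coeff_one_add_X_pow]
  have hcoeff (l : ℕ) : PowerSeries.coeff j
      ((-PowerSeries.X ^ 2) ^ l * 1 ^ (M + 1 - l) * ((M + 1).choose l : PowerSeries ℤ) *
        geomSeries ^ (M + 1)) =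
      if 2 * l ≤ j then
        (-1) ^ l * ((M + 1).choose l : ℤ) * ((M + j - 2 * l).choose (j - 2 * l) : ℤ)
      else 0 := by
    rw [show (-PowerSeries.X ^ 2) ^ l * 1 ^ (M + 1 - l) * ((M + 1).choose l : PowerSeries ℤ) *
        geomSeries ^ (M + 1) = PowerSeries.X ^ (2 * l) *
        (PowerSeries.C ((-1) ^ l * ((M + 1).choose l : ℤ)) * geomSeries ^ (M + 1)) by
          rw [neg_pow, one_pow, ← pow_mul]; simp; ring,
      PowerSeries.coeff_X_pow_mul']
    split_ifs with h
    · rw [PowerSeries.coeff_C_mul, geomSeries, PowerSeries.mk_one_pow_eq_mk_choose_add,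
        PowerSeries.coeff_mk, Nat.choose_symm_add, Nat.add_sub_assoc h]
    · rfl
  rw [hl, hfac, add_pow, Finset.sum_mul, map_sum]
  simp only [hcoeff]
  rw [← Finset.sum_filter]
  refine Finset.sum_subset_zero_on_sdiff (fun l hl => ?_) (fun l hl => ?_) (fun l _ => rfl)
  · simp only [Finset.mem_filter, Finset.mem_range] at hl ⊢
    omega
  · simp only [Finset.mem_sdiff, Finset.mem_filter, Finset.mem_range] at hl
    rw [Nat.choose_eq_zero_of_lt (by omega : M + 1 < l)]
    simp

theorem sum_extBinom_two_eq {d n k : ℕ} (hk : k ≤ n) :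
    ∑ j ∈ Finset.range (k + 1), (-1 : ℤ) ^ (k - j) * ((d - j).choose (k - j) : ℤ) *
        (extBinom (n - j + 1) 2 j : ℤ) =
      ∑ l ∈ Finset.range (k / 2 + 1), (-1 : ℤ) ^ l * ∑ j ∈ Finset.Icc (2 * l) k,
        (-1 : ℤ) ^ (k - j) * ((d - j).choose (k - j) : ℤ) *
          ((n - j + 1).choose l : ℤ) * ((n - 2 * l).choose (j - 2 * l) : ℤ) := by
  simp only [Finset.mul_sum]
  rw [← Finset.sum_comm' (s := Finset.range (k + 1)) (t := fun j => Finset.range (j / 2 + 1))]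
  · refine Finset.sum_congr rfl fun j hj => ?_
    rw [Finset.mem_range] at hj
    rw [extBinom_two, choose_succ_eq_sum_neg_one_pow_mul_choose, Finset.mul_sum,
      Nat.sub_add_cancel (by omega : j ≤ n)]
    exact Finset.sum_congr rfl fun l _ => by ring
  · intro j l
    simp only [Finset.mem_range, Finset.mem_Icc]
    omega

theorem natCeil_div_three (n : ℕ) : ⌈(n : ℚ) / 3⌉₊ = (n + 2) / 3 := by
  apply le_antisymm
  · rw [Nat.ceil_le, div_le_iff₀ (by norm_num)]
    exact_mod_cast (by omega : n ≤ (n + 2) / 3 * 3)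
  · rcases Nat.eq_zero_or_pos ((n + 2) / 3) with h | h
    · omega
    · rw [← Nat.sub_one_add_one h.ne', Nat.add_one_le_iff, Nat.lt_ceil, lt_div_iff₀ (by norm_num)]
      exact_mod_cast (by omega : ((n + 2) / 3 - 1) * 3 < n)

theorem pathPhi_two (n : ℕ) : pathPhi n 2 = ((n + 2) / 3 : ℕ) := by
  have hf : ⌊((n : ℚ) + 1) / (((2 : ℕ) : ℚ) + 1)⌋ = ((n + 1) / 3 : ℕ) := by
    have h1 : (n + 1) / 3 * 3 ≤ n + 1 := by omega
    have h2 : n + 1 < ((n + 1) / 3 + 1) * 3 := by omega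
    generalize (n + 1) / 3 = q at h1 h2 ⊢
    rw [Int.floor_eq_iff, le_div_iff₀ (by norm_num), div_lt_iff₀ (by norm_num)]
    exact ⟨by exact_mod_cast h1, by exact_mod_cast h2⟩
  have hc : ⌈((n : ℚ) + 1) / (((2 : ℕ) : ℚ) + 1)⌉ = ((n + 3) / 3 : ℕ) := by
    have h1 : (n + 3) / 3 * 3 < n + 1 + 3 := by omega
    have h2 : n + 1 ≤ (n + 3) / 3 * 3 := by omega
    generalize (n + 3) / 3 = q at h1 h2 ⊢
    rw [Int.ceil_eq_iff, lt_div_iff₀ (by norm_num), div_le_iff₀ (by norm_num)]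
    refine ⟨?_, by exact_mod_cast h2⟩
    have : ((q * 3 : ℕ) : ℚ) < ((n + 1 + 3 : ℕ) : ℚ) := by exact_mod_cast h1
    push_cast at this ⊢
    linarith
  rw [pathPhi, hf, hc]
  omega

theorem floor_two_mul_div_three (n : ℕ) : ⌊2 * (n : ℚ) / 3⌋ = ((2 * n / 3 : ℕ) : ℤ) := by
  rw [Int.floor_eq_iff, le_div_iff₀ (by norm_num), div_lt_iff₀ (by norm_num)]
  have h1 : 2 * n / 3 * 3 ≤ 2 * n := by omega
  have h2 : 2 * n < (2 * n / 3 + 1) * 3 := by omega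
  exact ⟨by exact_mod_cast h1, by exact_mod_cast h2⟩

theorem nonnegCoeffs_pathSeries_of_pos {n : ℕ} (hn : 1 ≤ n) :
    NonnegCoeffs ((1 - PowerSeries.X) ^ ((n + 2) / 3) * pathSeries n) := by
  have h := nonnegCoeffs_one_sub_X_pow_mul_pathSeries ((n - 1) / 3)
  have hd : (n + 2) / 3 = (n - 1) / 3 + 1 := by omega
  rw [hd]
  rcases (by omega : n = 3 * ((n - 1) / 3) + 1 ∨ n = 3 * ((n - 1) / 3) + 2 ∨
    n = 3 * ((n - 1) / 3) + 3) with h1 | h1 | h1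
  · rw [← h1] at h; exact h.1
  · rw [← h1] at h; exact h.2.1
  · rw [← h1] at h; exact h.2.2

theorem nonnegCoeffs_geomSeries_sub_pathSeries_of_two_le {n : ℕ} (hn : 2 ≤ n) :
    NonnegCoeffs (geomSeries ^ (2 * n / 3 - 1) -
      (1 - PowerSeries.X) ^ ((n + 2) / 3 + 1) * pathSeries n) := by
  obtain ⟨m, rfl | rfl | rfl⟩ : ∃ m, n = 3 * m + 2 ∨ n = 3 * m + 3 ∨ n = 3 * m + 4 :=
    ⟨(n - 2) / 3, by omega⟩
  · convert (nonnegCoeffs_geomSeries_pow_sub_pathSeries m).1 using 4 <;> omega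
  · convert (nonnegCoeffs_geomSeries_pow_sub_pathSeries m).2.1 using 4 <;> omega
  · convert (nonnegCoeffs_geomSeries_pow_sub_pathSeries m).2.2 using 4 <;> omega

theorem mainTheorem7 (K : Type*) [Field K] (n : ℕ) (hn : 2 ≤ n) :
    ((⌈(n : ℚ) / 3⌉₊ : ℤ) = pathPhi n 2) ∧
    (∀ k : ℕ, k ≤ n →
      alphaQuot (pathIdeal K n 2) k = (n - k + 1).choose k ∧
      extBinom (n - k + 1) 2 k = (n - k + 1).choose k) ∧
    (∀ k : ℕ, k ≤ ⌈(n : ℚ) / 3⌉₊ →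
      ∑ j ∈ Finset.range (k + 1),
          (-1 : ℤ) ^ (k - j) * ((⌈(n : ℚ) / 3⌉₊ - j).choose (k - j) : ℤ) *
            (extBinom (n - j + 1) 2 j : ℤ) =
        ∑ l ∈ Finset.range (k / 2 + 1), (-1 : ℤ) ^ l *
          ∑ j ∈ Finset.Icc (2 * l) k,
            (-1 : ℤ) ^ (k - j) * ((⌈(n : ℚ) / 3⌉₊ - j).choose (k - j) : ℤ) *
              ((n - j + 1).choose l : ℤ) * ((n - 2 * l).choose (j - 2 * l) : ℤ)) ∧
    (∀ k : ℕ, k ≤ ⌈(n : ℚ) / 3⌉₊ →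
      0 ≤ ∑ j ∈ Finset.range (k + 1),
          (-1 : ℤ) ^ (k - j) * ((⌈(n : ℚ) / 3⌉₊ - j).choose (k - j) : ℤ) *
            ((n - j + 1).choose j : ℤ)) ∧
    (∀ k : ℕ, k ≤ ⌈(n : ℚ) / 3⌉₊ + 1 →
      ∑ j ∈ Finset.range (k + 1),
          (-1 : ℤ) ^ (k - j) * ((⌈(n : ℚ) / 3⌉₊ + 1 - j).choose (k - j) : ℤ) *
            ((n - j + 1).choose j : ℤ) ≤
        Ring.choose (⌊2 * (n : ℚ) / 3⌋ + (k : ℤ) - 2) k) := by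
  rw [natCeil_div_three, floor_two_mul_div_three]
  refine ⟨(pathPhi_two n).symm, fun k hk => ⟨?_, extBinom_two _ _⟩,
    fun k hk => sum_extBinom_two_eq (by omega), fun k hk => ?_, fun k hk => ?_⟩
  · rw [alphaQuot_pathIdeal_two, Nat.sub_add_comm hk]
  · rw [← coeff_one_sub_X_pow_mul_pathSeries hk (by omega)]
    exact nonnegCoeffs_pathSeries_of_pos (by omega) k
  · rw [← coeff_one_sub_X_pow_mul_pathSeries hk (by omega),
      show ((2 * n / 3 : ℕ) : ℤ) + (k : ℤ) - 2 = ((2 * n / 3 - 1 : ℕ) : ℤ) + k - 1 by omega,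
      ← coeff_geomSeries_pow, ← sub_nonneg, ← map_sub]
    exact nonnegCoeffs_geomSeries_sub_pathSeries_of_two_le hn k
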